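/- Theorem (Soundness and completeness with respect to Mkrtychev-style models). **Language.** Let $\mathsf{Ag}=\{1,\dots,h\}$ be a finite set of agents and let $\mathsf{Const},\mathsf{Var},\mathsf{Prop}$ be sets (constants, variables, atomic propositions; in particular they may be countable). Terms: $t ::= c \mid x \mid\, !t \mid t+t \mid t\cdot t$. Formulas: $$\phi ::= P \mid \bot \mid \phi\to\phi \mid \bigcirc\phi \mid \mathsf W\phi \mid \phi\,\mathcal U\,\phi \mid \phi\,\mathcal S\,\phi \mid [t]_i\phi \qquad (i\in\mathsf{Ag}).$$ The operators $\bigcirc,\mathsf W,\mathcal U,\mathcal S$ are next, weak previous, until and since; $\mathsf Y$ below is strong previous. Abbreviations: $\neg\phi:=\phi\to\bot$, $\top:=\neg\bot$, $\phi\vee\psi:=\neg\phi\to\psi$, $\phi\wedge\psi:=\neg(\neg\phi\vee\neg\psi)$, $\phi\leftrightarrow\psi:=(\phi\to\psi)\wedge(\psi\to\phi)$, $\mathsf Y\phi:=\neg \mathsf W\neg\phi$, $\Box\phi:=\neg(\top\,\mathcal U\,\neg\phi)$, $\Diamond\phi:=\neg\Box\neg\phi$, $\boxminus\phi:=\neg(\top\,\mathcal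 S\,\neg\phi)$, $\blacklozenge\phi:=\neg\boxminus\neg\phi$. **Proof system.** The axioms are all instances of: propositional tautologies; $\bigcirc(\phi\to\psi)\to(\bigcirc\phi\to\bigcirc\psi)$; $\Box(\phi\to\psi)\to(\Box\phi\to\Box\psi)$; $\bigcirc\neg\phi\leftrightarrow\neg\bigcirc\phi$; $\Box(\phi\to\bigcirc\phi)\to(\phi\to\Box\phi)$; $\phi\,\mathcal U\,\psi\to\Diamond\psi$; $\phi\,\mathcal U\,\psi\leftrightarrow\psi\vee(\phi\wedge\bigcirc(\phi\,\mathcal U\,\psi))$; $\boxminus(\phi\to\psi)\to(\boxminus\phi\to\boxminus\psi)$; $\mathsf W(\phi\to\psi)\to(\mathsf W\phi\to \mathsf W\psi)$; $\mathsf Y\phi\to \mathsf W\phi$; $\phi\to\bigcirc \mathsf Y\phi$; $\phi\to \mathsf W\bigcirc\phi$; $\blacklozenge \mathsf W\bot$; $\boxminus(\phi\to \mathsf W\phi)\to(\phi\to\boxminus\phi)$; $\phi\,\mathcal S\,\psi\to\blacklozenge\psi$; $\phi\,\mathcal S\,\psi\leftrightarrow\psi\vee(\phi\wedge \mathsf Y(\phi\,\mathcal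 S\,\psi))$; $[t]_i(\phi\to\psi)\to([s]_i\phi\to[t\cdot s]_i\psi)$; $[t]_i\phi\to[t+s]_i\phi$; $[s]_i\phi\to[t+s]_i\phi$; $[t]_i\phi\to\phi$; $[t]_i\phi\to[!t]_i[t]_i\phi$. A constant specification $\mathsf{CS}$ is a set of formulas of the form $[c_n]_{i_n}\cdots[c_1]_{i_1}\phi$ with $n\ge 1$, $c_1,\dots,c_n\in\mathsf{Const}$ and $\phi$ an axiom, such that if $n>1$ and $[c_n]_{i_n}[c_{n-1}]_{i_{n-1}}\cdots[c_1]_{i_1}\phi\in\mathsf{CS}$, then $[c_{n-1}]_{i_{n-1}}\cdots[c_1]_{i_1}\phi\in\mathsf{CS}$. The system $\mathsf{LPLTL}^{\mathsf P}_{\mathsf{CS}}$ has these axioms, the rule that every element of $\mathsf{CS}$ is derivable, modus ponens, and the rules $\phi/\bigcirc\phi$, $\phi/\mathsf W\phi$, $\phi/\Box\phi$, $\phi/\boxminus\phi$; $\vdash_{\mathsf{CS}}\phi$ means that $\phi$ is derivable. $\Gamma\vdash_{\mathsf{CS}}\phi$ means that $\phi$ is derivable from assumptions in $\Gamma$, where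 the last four rules may be applied only to formulas derivable without assumptions. **Models.** An $\mathsf{LPLTL}^{\mathsf P}_{\mathsf{CS}}$-model is a tuple $\mathcal M=(r,S,\mathcal E_1,\dots,\mathcal E_h,\nu)$ with $S$ a non-empty set, $r:\mathbb N\to S$, $\nu:S\to\mathcal P(\mathsf{Prop})$, and functions $\mathcal E_i:S\times\mathsf{Tm}\to\mathcal P(\mathsf{Fml})$, where $\mathsf{Tm}$ and $\mathsf{Fml}$ are the sets of terms and formulas, such that for all $w,s,t,\phi,\psi$: if $[t]_i\phi\in\mathsf{CS}$ then $\phi\in\mathcal E_i(w,t)$; if $\phi\to\psi\in\mathcal E_i(w,t)$ and $\phi\in\mathcal E_i(w,s)$ then $\psi\in\mathcal E_i(w,t\cdot s)$; $\mathcal E_i(w,s)\cup\mathcal E_i(w,t)\subseteq\mathcal E_i(w,s+t)$; if $\phi\in\mathcal E_i(w,t)$ then $[t]_i\phi\in\mathcal E_i(w,!t)$. Truth at position $n\in\mathbb N$ of the run is defined by: $P$ holds iff $P\in\nu(r(n))$; $\bot$ never holds; $\phi\to\psi$ holds iff $\phi$ does not or $\psi$ does; $\bigcirc\phi$ iff $\phi$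 holds at $n+1$; $\mathsf W\phi$ iff $n=0$ or $\phi$ holds at $n-1$; $\phi\,\mathcal U\,\psi$ iff there is $m\ge n$ such that $\psi$ holds at $m$ and $\phi$ holds at all $k$ with $n\le k<m$; $\phi\,\mathcal S\,\psi$ iff there is $m\le n$ such that $\psi$ holds at $m$ and $\phi$ holds at all $k$ with $m<k\le n$; $[t]_i\phi$ iff $\phi\in\mathcal E_i(r(n),t)$ and $\phi$ holds at $n$. Write $\mathcal M\vDash\phi$ if $\phi$ holds at every $n$, and $\Gamma\Vdash_{\mathsf{CS}}\phi$ if for every model $\mathcal M$ and every $n$ at which all elements of $\Gamma$ hold, $\phi$ holds at $n$. **Claim.** For every constant specification $\mathsf{CS}$: (1) for every formula $\phi$: $\vdash_{\mathsf{CS}}\phi$ if and only if $\mathcal M\vDash\phi$ for all $\mathsf{LPLTL}^{\mathsf P}_{\mathsf{CS}}$-models $\mathcal M$; (2) for every finite set $\Gamma$ of formulas and every formula $\phi$: $\Gamma\vdash_{\mathsf{CS}}\phi$ if and only if $\Gamma\Vdash_{\mathsf{CS}}\phi$. -/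

import Mathlib

universe u v w x

namespace LPLTLP

/-- Justification terms over constants `C` and variables `V`. -/
inductive Tm (C : Type u) (V : Type v) : Type (max u v)
  | const : C → Tm C V
  | var : V → Tm C V
  | bang : Tm C V → Tm C V
  | plus : Tm C V → Tm C V → Tm C V
  | app : Tm C V → Tm C V → Tm C V

/-- Formulas over `h` agents, constants `C`, variables `V` and atomic propositions `P`.
`next`, `wprev`, `untl`, `since` are the primitive temporal operators next, weak previous, until
and since; `just t i φ` is the justification assertion `[t]_i φ`. -/
inductive Fml (h : ℕ) (C : Type u) (V : Type v) (P : Type w) : Type (max u v w)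
  | atom : P → Fml h C V P
  | bot : Fml h C V P
  | imp : Fml h C V P → Fml h C V P → Fml h C V P
  | next : Fml h C V P → Fml h C V P
  | wprev : Fml h C V P → Fml h C V P
  | untl : Fml h C V P → Fml h C V P → Fml h C V P
  | since : Fml h C V P → Fml h C V P → Fml h C V P
  | just : Tm C V → Fin h → Fml h C V P → Fml h C V P

namespace Fml

variable {h : ℕ} {C : Type u} {V : Type v} {P : Type w}

/-- Negation. -/
def neg (φ : Fml h C V P) : Fml h C V P := imp φ bot

/-- Truth constant. -/
def top : Fml h C V P := neg bot

/-- Disjunction. -/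
def or (φ ψ : Fml h C V P) : Fml h C V P := imp (neg φ) ψ

/-- Conjunction. -/
def and (φ ψ : Fml h C V P) : Fml h C V P := neg (or (neg φ) (neg ψ))

/-- Equivalence. -/
def iff (φ ψ : Fml h C V P) : Fml h C V P := and (imp φ ψ) (imp ψ φ)

/-- Strong previous. -/
def sprev (φ : Fml h C V P) : Fml h C V P := neg (wprev (neg φ))

/-- Always from now on. -/
def always (φ : Fml h C V P) : Fml h C V P := neg (untl top (neg φ))

/-- Sometime (eventually), the dual of `always`. It has the same truth condition as `untl top φ`,
but in the Hilbert system below the two are interderivable only because `ev` is literally the dual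
of `always`: with `untl top φ` for `ev φ`, the scheme `untl1` would say nothing about `always`
unless `ψ` is a negation. -/
def ev (φ : Fml h C V P) : Fml h C V P := neg (always (neg φ))

/-- Has always been. -/
def hist (φ : Fml h C V P) : Fml h C V P := neg (since top (neg φ))

/-- Once (at some past or present time), the dual of `hist`; see the remark on `ev`. -/
def once (φ : Fml h C V P) : Fml h C V P := neg (hist (neg φ))

/-- Propositional tautologies of the full language: formulas that are true under every assignment
of truth values to formulas that respects `⊥` and `→` (so that every formula which is neither `⊥`
nor an implication behaves like a propositional atom). -/
def IsTaut (φ : Fml h C V P) : Prop :=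
  ∀ val : Fml h C V P → Prop, ¬ val bot → (∀ α β, val (imp α β) ↔ (val α → val β)) → val φ

/-- The instances of the axiom schemes of propositional logic, temporal logic with past, and
justification logic. -/
inductive AxInst : Fml h C V P → Prop
  | taut (φ : Fml h C V P) : IsTaut φ → AxInst φ
  -- future operators
  | nextK (φ ψ : Fml h C V P) :
      AxInst (imp (next (imp φ ψ)) (imp (next φ) (next ψ)))
  | alwaysK (φ ψ : Fml h C V P) :
      AxInst (imp (always (imp φ ψ)) (imp (always φ) (always ψ)))
  | func (φ : Fml h C V P) : AxInst (iff (next (neg φ)) (neg (next φ)))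
  | ind (φ : Fml h C V P) :
      AxInst (imp (always (imp φ (next φ))) (imp φ (always φ)))
  | untl1 (φ ψ : Fml h C V P) : AxInst (imp (untl φ ψ) (ev ψ))
  | untl2 (φ ψ : Fml h C V P) :
      AxInst (iff (untl φ ψ) (or ψ (and φ (next (untl φ ψ)))))
  -- past operators
  | histK (φ ψ : Fml h C V P) :
      AxInst (imp (hist (imp φ ψ)) (imp (hist φ) (hist ψ)))
  | wprevK (φ ψ : Fml h C V P) :
      AxInst (imp (wprev (imp φ ψ)) (imp (wprev φ) (wprev ψ)))
  | sw (φ : Fml h C V P) : AxInst (imp (sprev φ) (wprev φ))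
  | fp (φ : Fml h C V P) : AxInst (imp φ (next (sprev φ)))
  | pf (φ : Fml h C V P) : AxInst (imp φ (wprev (next φ)))
  | initial : AxInst (once (wprev bot))
  | histInd (φ : Fml h C V P) :
      AxInst (imp (hist (imp φ (wprev φ))) (imp φ (hist φ)))
  | since1 (φ ψ : Fml h C V P) : AxInst (imp (since φ ψ) (once ψ))
  | since2 (φ ψ : Fml h C V P) :
      AxInst (iff (since φ ψ) (or ψ (and φ (sprev (since φ ψ)))))
  -- justifications
  | application (t s : Tm C V) (i : Fin h) (φ ψ : Fml h C V P) :
      AxInst (imp (just t i (imp φ ψ)) (imp (just s i φ) (just (t.app s) i ψ)))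
  | sumLeft (t s : Tm C V) (i : Fin h) (φ : Fml h C V P) :
      AxInst (imp (just t i φ) (just (t.plus s) i φ))
  | sumRight (t s : Tm C V) (i : Fin h) (φ : Fml h C V P) :
      AxInst (imp (just s i φ) (just (t.plus s) i φ))
  | reflexivity (t : Tm C V) (i : Fin h) (φ : Fml h C V P) :
      AxInst (imp (just t i φ) φ)
  | posIntrospection (t : Tm C V) (i : Fin h) (φ : Fml h C V P) :
      AxInst (imp (just t i φ) (just t.bang i (just t i φ)))

/-- `iterJust [(cₙ, iₙ), …, (c₁, i₁)] φ` is `[cₙ]_{iₙ} … [c₁]_{i₁} φ`. -/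
def iterJust : List (C × Fin h) → Fml h C V P → Fml h C V P
  | [], φ => φ
  | p :: l, φ => just (Tm.const p.1) p.2 (iterJust l φ)

end Fml

open Fml

/-- `CS` is a constant specification: all its elements have the form `[cₙ]_{iₙ} … [c₁]_{i₁} φ` with
`n ≥ 1`, constants `cⱼ` and an axiom instance `φ`, and for `n > 1` it contains with such a formula
also `[cₙ₋₁]_{iₙ₋₁} … [c₁]_{i₁} φ`. -/
structure IsConstSpec {h : ℕ} {C : Type u} {V : Type v} {P : Type w}
    (CS : Set (Fml h C V P)) : Prop where
  shape : ∀ θ ∈ CS, ∃ (l : List (C × Fin h)) (φ : Fml h C V P),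
    l ≠ [] ∧ AxInst φ ∧ θ = iterJust l φ
  downward : ∀ (p : C × Fin h) (l : List (C × Fin h)) (φ : Fml h C V P),
    l ≠ [] → AxInst φ → iterJust (p :: l) φ ∈ CS → iterJust l φ ∈ CS

/-- `Prov CS φ`: the formula `φ` is derivable in the Hilbert system with constant specification
`CS`. -/
inductive Prov {h : ℕ} {C : Type u} {V : Type v} {P : Type w} (CS : Set (Fml h C V P)) :
    Fml h C V P → Prop
  | ax {φ : Fml h C V P} : AxInst φ → Prov CS φ
  | mp {φ ψ : Fml h C V P} : Prov CS φ → Prov CS (imp φ ψ) → Prov CS ψ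
  | iaxNec {φ : Fml h C V P} : φ ∈ CS → Prov CS φ
  | nextNec {φ : Fml h C V P} : Prov CS φ → Prov CS (next φ)
  | wprevNec {φ : Fml h C V P} : Prov CS φ → Prov CS (wprev φ)
  | alwaysNec {φ : Fml h C V P} : Prov CS φ → Prov CS (always φ)
  | histNec {φ : Fml h C V P} : Prov CS φ → Prov CS (hist φ)

/-- `Derives CS Γ φ`: the formula `φ` is derivable from the assumptions `Γ`; the necessitation rules
apply only to formulas derivable without assumptions. -/
inductive Derives {h : ℕ} {C : Type u} {V : Type v} {P : Type w} (CS : Set (Fml h C V P)) :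
    Set (Fml h C V P) → Fml h C V P → Prop
  | prem {Γ : Set (Fml h C V P)} {φ : Fml h C V P} : φ ∈ Γ → Derives CS Γ φ
  | ax {Γ : Set (Fml h C V P)} {φ : Fml h C V P} : AxInst φ → Derives CS Γ φ
  | mp {Γ Δ : Set (Fml h C V P)} {φ ψ : Fml h C V P} :
      Derives CS Γ φ → Derives CS Δ (imp φ ψ) → Derives CS (Γ ∪ Δ) ψ
  | iaxNec {Γ : Set (Fml h C V P)} {φ : Fml h C V P} : φ ∈ CS → Derives CS Γ φ
  | nextNec {Γ : Set (Fml h C V P)} {φ : Fml h C V P} : Prov CS φ → Derives CS Γ (next φ)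
  | wprevNec {Γ : Set (Fml h C V P)} {φ : Fml h C V P} : Prov CS φ → Derives CS Γ (wprev φ)
  | alwaysNec {Γ : Set (Fml h C V P)} {φ : Fml h C V P} : Prov CS φ → Derives CS Γ (always φ)
  | histNec {Γ : Set (Fml h C V P)} {φ : Fml h C V P} : Prov CS φ → Derives CS Γ (hist φ)

/-- `E : S → Tm → 𝒫(Fml)` is an evidence function for agent `i` and the constant specification `CS`
(no monotonicity condition, since there are no accessibility relations). -/
structure IsEvidence {h : ℕ} {C : Type u} {V : Type v} {P : Type w} (CS : Set (Fml h C V P))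
    {S : Type x} (i : Fin h) (E : S → Tm C V → Set (Fml h C V P)) : Prop where
  constSpec : ∀ (s : S) (t : Tm C V) (φ : Fml h C V P), just t i φ ∈ CS → φ ∈ E s t
  application : ∀ (s : S) (t₁ t₂ : Tm C V) (φ ψ : Fml h C V P),
    imp φ ψ ∈ E s t₁ → φ ∈ E s t₂ → ψ ∈ E s (t₁.app t₂)
  sum : ∀ (s : S) (t₁ t₂ : Tm C V), E s t₁ ∪ E s t₂ ⊆ E s (t₁.plus t₂)
  posIntrospection : ∀ (s : S) (t : Tm C V) (φ : Fml h C V P),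
    φ ∈ E s t → just t i φ ∈ E s t.bang

/-- Mkrtychev-style models `(r, S, E₁, …, E_h, ν)` for `CS`. -/
structure MModel {h : ℕ} {C : Type u} {V : Type v} {P : Type w} (CS : Set (Fml h C V P)) where
  /-- the states -/
  S : Type x
  nonempty : Nonempty S
  /-- the run -/
  r : ℕ → S
  /-- the evidence functions -/
  E : Fin h → S → Tm C V → Set (Fml h C V P)
  evidence : ∀ i, IsEvidence CS i (E i)
  /-- the valuation -/
  ν : S → Set P

/-- `M.Sat φ n`: truth of `φ` in `M` at the `n`-th position of the run. -/
def MModel.Sat {h : ℕ} {C : Type u} {V : Type v} {P : Type w} {CS : Set (Fml h C V P)}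
    (M : MModel.{u, v, w, x} CS) : Fml h C V P → ℕ → Prop
  | atom p, n => p ∈ M.ν (M.r n)
  | bot, _ => False
  | imp φ ψ, n => ¬ M.Sat φ n ∨ M.Sat ψ n
  | next φ, n => M.Sat φ (n + 1)
  | wprev φ, n => n = 0 ∨ M.Sat φ (n - 1)
  | untl φ ψ, n => ∃ m, n ≤ m ∧ M.Sat ψ m ∧ ∀ k, n ≤ k → k < m → M.Sat φ k
  | since φ ψ, n => ∃ m, m ≤ n ∧ M.Sat ψ m ∧ ∀ k, m < k → k ≤ n → M.Sat φ k
  | just t i φ, n => φ ∈ M.E i (M.r n) t ∧ M.Sat φ n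

/-- `φ` is true in the model `M`. -/
def MModel.Valid {h : ℕ} {C : Type u} {V : Type v} {P : Type w} {CS : Set (Fml h C V P)}
    (M : MModel.{u, v, w, x} CS) (φ : Fml h C V P) : Prop :=
  ∀ n, M.Sat φ n

/-- Local consequence over all models for `CS` (with states in the universe `x`). -/
def Conseq {h : ℕ} {C : Type u} {V : Type v} {P : Type w} (CS : Set (Fml h C V P))
    (Γ : Set (Fml h C V P)) (φ : Fml h C V P) : Prop :=
  ∀ (M : MModel.{u, v, w, x} CS) (n : ℕ), (∀ ψ ∈ Γ, M.Sat ψ n) → M.Sat φ n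

end LPLTLP

/-!
Soundness is a direct induction; membership in `CS` is handled by induction on the length of the
prefix of constants, using downward closure.

Completeness combines a canonical construction for the justification part with a filtration for the
temporal part. A *world* is a maximal consistent set of formulas of the full language, and a formula
is derivable iff it belongs to all worlds (`prov_iff_forall_mem`), so derivations can be replaced by
arguments about worlds. Each world `M` has a successor `M.succ = {φ | ○φ ∈ M}`, and each world
without `W⊥` has a predecessor. The sequence of successors need not fulfil the until-formulas, so one
fixes a finite set `Σ` closed under subformulas and identifies worlds that agree on `Σ`: there is a
`Step` from `M` to `N` if, up to this identification, `N` is the successor of `M`. As `Σ` is finite,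
every set of worlds that is invariant under the identification is defined by a single formula
(`exists_defining_formula`). Applied to the set of worlds from which some goal cannot be reached by
steps, the induction axioms for `□` and `⊟` show that every until-formula can be fulfilled by a finite
forward path (`exists_reach_untl`), and that every world lies on a finite path that begins in a world
with `W⊥` (`exists_reach_initial`). A fair scheduling of these finite paths gives an infinite run on
which membership and truth coincide for the formulas of `Σ` (`sat_iff_mem`).

The evidence at a position is read off the whole world sitting there: `φ` is evidence for `t` iff
`[t]_i φ` belongs to the world. Hence the closure conditions on evidence functions, which lead out of
every finite set, follow at once from the axioms, while in the truth lemma `[t]_i φ` is handled by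
reflexivity alone.
-/

namespace LPLTLP

open Fml

variable {h : ℕ} {C : Type u} {V : Type v} {P : Type w} {CS : Set (Fml h C V P)}

/-! ### Soundness -/

namespace MModel

variable (M : MModel.{u, v, w, x} CS) (φ ψ : Fml h C V P) (n : ℕ)

theorem sat_imp : M.Sat (imp φ ψ) n ↔ (M.Sat φ n → M.Sat ψ n) := by
  rw [MModel.Sat, imp_iff_not_or]

theorem sat_bot : ¬ M.Sat bot n := id

theorem sat_neg : M.Sat (neg φ) n ↔ ¬ M.Sat φ n := by
  rw [neg, sat_imp, iff_false_intro (M.sat_bot n)]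

theorem sat_or : M.Sat (Fml.or φ ψ) n ↔ M.Sat φ n ∨ M.Sat ψ n := by
  rw [Fml.or, sat_imp, sat_neg]; tauto

theorem sat_and : M.Sat (Fml.and φ ψ) n ↔ M.Sat φ n ∧ M.Sat ψ n := by
  rw [Fml.and, sat_neg, sat_or, sat_neg, sat_neg]; tauto

theorem sat_iff : M.Sat (Fml.iff φ ψ) n ↔ (M.Sat φ n ↔ M.Sat ψ n) := by
  rw [Fml.iff, sat_and, sat_imp, sat_imp]; tauto

theorem sat_next : M.Sat (next φ) n ↔ M.Sat φ (n + 1) := Iff.rfl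

theorem sat_wprev : M.Sat (wprev φ) n ↔ n = 0 ∨ M.Sat φ (n - 1) := Iff.rfl

theorem sat_sprev : M.Sat (sprev φ) n ↔ n ≠ 0 ∧ M.Sat φ (n - 1) := by
  rw [sprev, sat_neg, sat_wprev, sat_neg]; tauto

theorem sat_untl : M.Sat (untl φ ψ) n ↔
    ∃ m, n ≤ m ∧ M.Sat ψ m ∧ ∀ k, n ≤ k → k < m → M.Sat φ k := Iff.rfl

theorem sat_since : M.Sat (since φ ψ) n ↔
    ∃ m, m ≤ n ∧ M.Sat ψ m ∧ ∀ k, m < k → k ≤ n → M.Sat φ k := Iff.rfl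

theorem sat_just (t : Tm C V) (i : Fin h) :
    M.Sat (just t i φ) n ↔ φ ∈ M.E i (M.r n) t ∧ M.Sat φ n := Iff.rfl

theorem sat_top : M.Sat top n := by
  rw [top, sat_neg]; exact M.sat_bot n

theorem sat_always : M.Sat (always φ) n ↔ ∀ m, n ≤ m → M.Sat φ m := by
  simp only [always, sat_neg, sat_untl, sat_top, implies_true, and_true]
  push Not
  rfl

theorem sat_ev : M.Sat (ev φ) n ↔ ∃ m, n ≤ m ∧ M.Sat φ m := by
  simp only [ev, sat_neg, sat_always]
  push Not
  rfl

theorem sat_hist : M.Sat (hist φ) n ↔ ∀ m, m ≤ n → M.Sat φ m := by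
  simp only [hist, sat_neg, sat_since, sat_top, implies_true, and_true]
  push Not
  rfl

theorem sat_once : M.Sat (once φ) n ↔ ∃ m, m ≤ n ∧ M.Sat φ m := by
  simp only [once, sat_neg, sat_hist]
  push Not
  rfl

theorem sat_untl_unfold :
    M.Sat (untl φ ψ) n ↔ M.Sat ψ n ∨ (M.Sat φ n ∧ M.Sat (untl φ ψ) (n + 1)) := by
  simp only [sat_untl]
  constructor
  · rintro ⟨m, hm, hψ, hφ⟩
    rcases hm.eq_or_lt with rfl | hlt
    · exact Or.inl hψ
    · exact Or.inr ⟨hφ n le_rfl hlt, m, hlt, hψ, fun k hk => hφ k (by omega)⟩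
  · rintro (hψ | ⟨hφ, m, hm, hψ, hk⟩)
    · exact ⟨n, le_rfl, hψ, fun k _ _ => by omega⟩
    · refine ⟨m, by omega, hψ, fun k h1 h2 => ?_⟩
      rcases h1.eq_or_lt with rfl | hlt
      · exact hφ
      · exact hk k hlt h2

theorem sat_since_unfold :
    M.Sat (since φ ψ) n ↔ M.Sat ψ n ∨ (M.Sat φ n ∧ n ≠ 0 ∧ M.Sat (since φ ψ) (n - 1)) := by
  simp only [sat_since]
  constructor
  · rintro ⟨m, hm, hψ, hφ⟩
    rcases hm.eq_or_lt with rfl | hlt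
    · exact Or.inl hψ
    · exact Or.inr ⟨hφ n hlt le_rfl, by omega, m, by omega, hψ, fun k h1 h2 => hφ k h1 (by omega)⟩
  · rintro (hψ | ⟨hφ, hn, m, hm, hψ, hk⟩)
    · exact ⟨n, le_rfl, hψ, fun k _ _ => by omega⟩
    · refine ⟨m, by omega, hψ, fun k h1 h2 => ?_⟩
      rcases h2.eq_or_lt with rfl | hlt
      · exact hφ
      · exact hk k h1 (by omega)

theorem valid_of_axInst {φ : Fml h C V P} (hφ : AxInst φ) : M.Valid φ := by
  intro n
  cases hφ with
  | taut _ ht => exact ht (fun θ => M.Sat θ n) (M.sat_bot n) (fun α β => M.sat_imp α β n)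
  | nextK φ ψ => simp only [sat_imp, sat_next]; exact id
  | alwaysK φ ψ => simp only [sat_imp, sat_always]; exact fun h1 h2 m hm => h1 m hm (h2 m hm)
  | func φ => simp only [sat_iff, sat_next, sat_neg]
  | ind φ =>
    simp only [sat_imp, sat_always, sat_next]
    exact fun h1 h2 m hm => Nat.le_induction h2 h1 m hm
  | untl1 φ ψ =>
    simp only [sat_imp, sat_untl, sat_ev]
    exact fun ⟨m, hm, hψ, _⟩ => ⟨m, hm, hψ⟩
  | untl2 φ ψ =>
    rw [sat_iff, sat_or, sat_and, sat_next]
    exact M.sat_untl_unfold φ ψ n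
  | histK φ ψ => simp only [sat_imp, sat_hist]; exact fun h1 h2 m hm => h1 m hm (h2 m hm)
  | wprevK φ ψ => simp only [sat_imp, sat_wprev]; tauto
  | sw φ => simp only [sat_imp, sat_wprev, sat_sprev]; tauto
  | fp φ => simp only [sat_imp, sat_next, sat_sprev]; exact fun h1 => ⟨by omega, h1⟩
  | pf φ =>
    simp only [sat_imp, sat_next, sat_wprev]
    intro h1
    rcases n with _ | n
    · exact Or.inl rfl
    · exact Or.inr h1
  | initial =>
    rw [sat_once]
    exact ⟨0, Nat.zero_le n, Or.inl rfl⟩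
  | histInd φ =>
    simp only [sat_imp, sat_hist, sat_wprev]
    intro h1 h2 m hm
    refine Nat.decreasingInduction (motive := fun k _ => M.Sat φ k) (fun k hk ih => ?_) h2 hm
    simpa using h1 (k + 1) hk ih
  | since1 φ ψ =>
    simp only [sat_imp, sat_since, sat_once]
    exact fun ⟨m, hm, hψ, _⟩ => ⟨m, hm, hψ⟩
  | since2 φ ψ =>
    rw [sat_iff, sat_or, sat_and, sat_sprev]
    exact M.sat_since_unfold φ ψ n
  | application t s i φ ψ =>
    simp only [sat_imp, sat_just]
    exact fun h1 h2 => ⟨(M.evidence i).application _ t s φ ψ h1.1 h2.1, h1.2 h2.2⟩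
  | sumLeft t s i φ =>
    simp only [sat_imp, sat_just]
    exact fun h1 => ⟨(M.evidence i).sum _ t s (Or.inl h1.1), h1.2⟩
  | sumRight t s i φ =>
    simp only [sat_imp, sat_just]
    exact fun h1 => ⟨(M.evidence i).sum _ t s (Or.inr h1.1), h1.2⟩
  | reflexivity t i φ => simp only [sat_imp, sat_just]; exact And.right
  | posIntrospection t i φ =>
    simp only [sat_imp, sat_just]
    exact fun h1 => ⟨(M.evidence i).posIntrospection _ t φ h1.1, h1⟩

theorem valid_of_mem_constSpec (hCS : IsConstSpec CS) {θ : Fml h C V P} (hθ : θ ∈ CS) :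
    M.Valid θ := by
  intro n
  obtain ⟨l, φ, hl, hφ, rfl⟩ := hCS.shape θ hθ
  induction l with
  | nil => exact absurd rfl hl
  | cons p l ih =>
    refine ⟨(M.evidence p.2).constSpec _ _ _ hθ, ?_⟩
    by_cases hl' : l = []
    · subst hl'
      exact M.valid_of_axInst hφ n
    · exact ih hl' (hCS.downward p l φ hl' hφ hθ)

end MModel

theorem Prov.valid (hCS : IsConstSpec CS) (M : MModel.{u, v, w, x} CS) {φ : Fml h C V P}
    (hφ : Prov CS φ) : M.Valid φ := by
  induction hφ with
  | ax hφ => exact M.valid_of_axInst hφ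
  | mp _ _ ih1 ih2 => exact fun n => (M.sat_imp _ _ n).1 (ih2 n) (ih1 n)
  | iaxNec hφ => exact M.valid_of_mem_constSpec hCS hφ
  | nextNec _ ih => exact fun n => ih (n + 1)
  | wprevNec _ ih => exact fun n => Or.inr (ih (n - 1))
  | alwaysNec _ ih => exact fun n => (M.sat_always _ n).2 fun m _ => ih m
  | histNec _ ih => exact fun n => (M.sat_hist _ n).2 fun m _ => ih m

theorem Derives.conseq (hCS : IsConstSpec CS) {Γ : Set (Fml h C V P)} {φ : Fml h C V P}
    (hφ : Derives CS Γ φ) : Conseq.{u, v, w, x} CS Γ φ := by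
  induction hφ with
  | prem hφ => exact fun M n hΓ => hΓ _ hφ
  | ax hφ => exact fun M n _ => (Prov.ax hφ).valid hCS M n
  | mp _ _ ih1 ih2 =>
    exact fun M n hΓ => (M.sat_imp _ _ n).1 (ih2 M n fun ψ hψ => hΓ ψ (Or.inr hψ))
      (ih1 M n fun ψ hψ => hΓ ψ (Or.inl hψ))
  | iaxNec hφ => exact fun M n _ => (Prov.iaxNec hφ).valid hCS M n
  | nextNec hφ => exact fun M n _ => hφ.nextNec.valid hCS M n
  | wprevNec hφ => exact fun M n _ => hφ.wprevNec.valid hCS M n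
  | alwaysNec hφ => exact fun M n _ => hφ.alwaysNec.valid hCS M n
  | histNec hφ => exact fun M n _ => hφ.histNec.valid hCS M n

/-! ### Maximal consistent sets -/

/-- A world is a maximal consistent set of formulas, presented as a set of formulas that contains
all theorems and commutes with `⊥` and `→`. -/
structure World (CS : Set (Fml h C V P)) where
  /-- the formulas that hold in the world -/
  carrier : Set (Fml h C V P)
  prov_mem : ∀ {φ}, Prov CS φ → φ ∈ carrier
  bot_notMem : bot ∉ carrier
  imp_mem_iff : ∀ {φ ψ}, imp φ ψ ∈ carrier ↔ (φ ∈ carrier → ψ ∈ carrier)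

instance : Membership (Fml h C V P) (World CS) := ⟨fun M φ => φ ∈ M.carrier⟩

theorem Prov.of_isTaut {φ : Fml h C V P} (hφ : IsTaut φ) : Prov CS φ := .ax (.taut φ hφ)

/-- Lindenbaum's lemma, relative to an underivable formula `φ`: a set that is maximal among those
that contain all theorems, are closed under modus ponens and omit `φ` is a world. -/
theorem exists_world_notMem {φ : Fml h C V P} (hφ : ¬ Prov CS φ) : ∃ M : World CS, φ ∉ M := by
  let T : Set (Set (Fml h C V P)) := {A | (∀ α, Prov CS α → α ∈ A) ∧
    (∀ α β, α ∈ A → imp α β ∈ A → β ∈ A) ∧ φ ∉ A}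
  obtain ⟨A, -, hA⟩ := zorn_subset_nonempty T (by
    intro c hc hchain hne
    refine ⟨⋃₀ c, ⟨?_, ?_, ?_⟩, fun s hs => Set.subset_sUnion_of_mem hs⟩
    · intro α hα
      obtain ⟨s, hs⟩ := hne
      exact ⟨s, hs, (hc hs).1 α hα⟩
    · rintro α β ⟨s, hs, hαs⟩ ⟨t, ht, hαt⟩
      rcases hchain.total hs ht with hst | hst
      · exact ⟨t, ht, (hc ht).2.1 α β (hst hαs) hαt⟩
      · exact ⟨s, hs, (hc hs).2.1 α β hαs (hst hαt)⟩
    · rintro ⟨s, hs, hφs⟩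
      exact (hc hs).2.2 hφs) {α | Prov CS α} ⟨fun _ => id, fun _ _ => Prov.mp, hφ⟩
  obtain ⟨⟨hprov, hmp, hφA⟩, hmax⟩ := hA
  have htaut : ∀ α, IsTaut α → α ∈ A := fun α hα => hprov α (.of_isTaut hα)
  -- The formulas implied by `α` together with `A` form a larger theory, which has to contain `φ`.
  have key : ∀ α, α ∉ A → imp α φ ∈ A := by
    intro α hα
    by_contra hcon
    have hsub : A ⊆ {β | imp α β ∈ A} := fun β hβ =>
      hmp _ _ hβ (htaut _ fun val _ himp => by simp only [himp]; tauto)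
    refine hα (hmax (y := {β | imp α β ∈ A})
      ⟨fun β hβ => hsub (hprov β hβ), fun β γ hβ hγ => ?_, hcon⟩ hsub ?_)
    · refine hmp _ _ hγ (hmp _ _ hβ (htaut _ fun val _ himp => ?_))
      simp only [himp]; tauto
    · exact htaut _ fun val _ himp => by simp only [himp]; tauto
  refine ⟨⟨A, fun hα => hprov _ hα, fun hbot => ?_, fun {α β} => ⟨fun hαβ hα => hmp _ _ hα hαβ,
    fun hαβ => ?_⟩⟩, hφA⟩
  · exact hφA (hmp _ _ hbot (htaut _ fun val hb himp => by simp only [himp]; tauto))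
  · by_cases hα : α ∈ A
    · exact hmp _ _ (hαβ hα) (htaut _ fun val _ himp => by simp only [himp]; tauto)
    · by_contra hcon
      refine hφA (hmp _ _ (key _ hcon) (hmp _ _ (key _ hα) (htaut _ fun val _ himp => ?_)))
      simp only [himp]; tauto

theorem prov_iff_forall_mem {φ : Fml h C V P} : Prov CS φ ↔ ∀ M : World CS, φ ∈ M := by
  refine ⟨fun hφ M => M.prov_mem hφ, fun hφ => ?_⟩
  by_contra hcon
  obtain ⟨M, hM⟩ := exists_world_notMem hcon
  exact hM (hφ M)

namespace World

variable {M N : World CS} {φ ψ : Fml h C V P}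

theorem mem_imp : imp φ ψ ∈ M ↔ (φ ∈ M → ψ ∈ M) := M.imp_mem_iff

theorem mem_bot : bot ∈ M ↔ False := iff_false_intro M.bot_notMem

theorem mem_neg : neg φ ∈ M ↔ φ ∉ M := by
  rw [neg, mem_imp, mem_bot]

theorem mem_or : Fml.or φ ψ ∈ M ↔ φ ∈ M ∨ ψ ∈ M := by
  rw [Fml.or, mem_imp, mem_neg]; tauto

theorem mem_and : Fml.and φ ψ ∈ M ↔ φ ∈ M ∧ ψ ∈ M := by
  rw [Fml.and, mem_neg, mem_or, mem_neg, mem_neg]; tauto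

theorem mem_iff : Fml.iff φ ψ ∈ M ↔ (φ ∈ M ↔ ψ ∈ M) := by
  rw [Fml.iff, mem_and, mem_imp, mem_imp]; tauto

theorem ax_mem (hφ : AxInst φ) : φ ∈ M := M.prov_mem (.ax hφ)

theorem mp_ax (hφ : AxInst (imp φ ψ)) : φ ∈ M → ψ ∈ M := mem_imp.1 (ax_mem hφ)

theorem mem_next_neg : next (neg φ) ∈ M ↔ next φ ∉ M := by
  rw [← mem_neg]; exact mem_iff.1 (ax_mem (.func φ))

theorem mem_next_imp : next (imp φ ψ) ∈ M ↔ (next φ ∈ M → next ψ ∈ M) := by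
  have mono : ∀ {α β : Fml h C V P}, IsTaut (imp α β) → next α ∈ M → next β ∈ M := fun ht =>
    mem_imp.1 (mp_ax (.nextK _ _) (M.prov_mem (Prov.of_isTaut ht).nextNec))
  refine ⟨fun h1 => mem_imp.1 (mp_ax (.nextK φ ψ) h1), fun h1 => ?_⟩
  by_cases hφ : next φ ∈ M
  · exact mono (fun val _ himp => by simp only [himp]; exact fun hψ _ => hψ) (h1 hφ)
  · exact mono (fun val hb himp => by simp only [neg, himp]; tauto) (mem_next_neg.2 hφ)

/-- The successor `{φ | ○φ ∈ M}` of a world. -/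
def succ (M : World CS) : World CS where
  carrier := {φ | next φ ∈ M}
  prov_mem hφ := M.prov_mem hφ.nextNec
  bot_notMem := by
    intro hb
    -- `⊥ → ⊥` is the negation of `⊥`, so `○` cannot hold of both.
    exact mem_next_neg.1 (mem_next_imp.2 id) hb
  imp_mem_iff := mem_next_imp

theorem mem_succ : φ ∈ M.succ ↔ next φ ∈ M := Iff.rfl

theorem mem_wprev_of_neg (hφ : wprev (neg φ) ∉ M) : wprev φ ∈ M :=
  mp_ax (.sw φ) (mem_neg.2 hφ)

theorem wprev_mono (ht : IsTaut (imp φ ψ)) : wprev φ ∈ M → wprev ψ ∈ M :=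
  mem_imp.1 (mp_ax (.wprevK _ _) (M.prov_mem (Prov.of_isTaut ht).wprevNec))

theorem mem_wprev_neg (hM : wprev bot ∉ M) : wprev (neg φ) ∈ M ↔ wprev φ ∉ M := by
  refine ⟨fun h1 h2 => hM (mem_imp.1 (mp_ax (.wprevK φ bot) h1) h2), fun h1 => ?_⟩
  by_contra h2
  exact h1 (mem_wprev_of_neg h2)

/-- The predecessor `{φ | Wφ ∈ M}` of a world that is not initial. -/
def pred (M : World CS) (hM : wprev bot ∉ M) : World CS where
  carrier := {φ | wprev φ ∈ M}
  prov_mem hφ := M.prov_mem hφ.wprevNec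
  bot_notMem := hM
  imp_mem_iff := by
    intro φ ψ
    refine ⟨fun h1 => mem_imp.1 (mp_ax (.wprevK φ ψ) h1), fun h1 => ?_⟩
    by_cases hφ : wprev φ ∈ M
    · exact wprev_mono (fun val _ himp => by simp only [himp]; tauto) (h1 hφ)
    · exact wprev_mono (fun val hb himp => by simp only [neg, himp]; tauto) ((mem_wprev_neg hM).2 hφ)

theorem mem_pred (hM : wprev bot ∉ M) : φ ∈ M.pred hM ↔ wprev φ ∈ M := Iff.rfl

theorem mem_succ_pred (hM : wprev bot ∉ M) : φ ∈ (M.pred hM).succ ↔ φ ∈ M := by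
  have incl : ∀ {α : Fml h C V P}, α ∈ M → α ∈ (M.pred hM).succ :=
    fun {α} hα => mp_ax (ψ := wprev (next α)) (.pf α) hα
  refine ⟨fun h1 => ?_, incl⟩
  by_contra h2
  exact mem_neg.1 (incl (mem_neg.2 h2)) h1

theorem wprev_mem_succ : wprev φ ∈ M.succ ↔ φ ∈ M := by
  constructor
  · intro h1
    by_contra h2
    have h3 : sprev (neg φ) ∈ M.succ :=
      mp_ax (M := M) (ψ := next (sprev (neg φ))) (.fp (neg φ)) (mem_neg.2 h2)
    refine mem_neg.1 h3 (wprev_mono (fun val hb himp => ?_) h1)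
    simp only [neg, himp]; tauto
  · intro h1
    have h3 : sprev φ ∈ M.succ := mp_ax (M := M) (ψ := next (sprev φ)) (.fp φ) h1
    exact mp_ax (.sw φ) h3

theorem mem_untl : untl φ ψ ∈ M ↔ ψ ∈ M ∨ (φ ∈ M ∧ untl φ ψ ∈ M.succ) := by
  rw [mem_succ, ← mem_and, ← mem_or]
  exact mem_iff.1 (ax_mem (.untl2 φ ψ))

theorem mem_since : since φ ψ ∈ M ↔ ψ ∈ M ∨ (φ ∈ M ∧ wprev (neg (since φ ψ)) ∉ M) := by
  rw [← mem_neg, ← mem_and, ← mem_or]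
  exact mem_iff.1 (ax_mem (.since2 φ ψ))

theorem mem_since_succ : since φ ψ ∈ M.succ ↔ ψ ∈ M.succ ∨ (φ ∈ M.succ ∧ since φ ψ ∈ M) := by
  rw [mem_since, wprev_mem_succ, mem_neg, not_not]

theorem mem_wprev_of_initial (hM : wprev bot ∈ M) : wprev φ ∈ M :=
  wprev_mono (fun val hb himp => by simp only [himp]; tauto) hM

theorem always_mem_of_invariant {χ : Fml h C V P} (hstep : ∀ N : World CS, χ ∈ N → χ ∈ N.succ)
    (himp : ∀ N : World CS, χ ∈ N → ψ ∈ N) (hM : χ ∈ M) : always ψ ∈ M := by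
  have h1 : Prov CS (imp χ (next χ)) := prov_iff_forall_mem.2 fun N => mem_imp.2 (hstep N)
  have h2 : Prov CS (imp χ ψ) := prov_iff_forall_mem.2 fun N => mem_imp.2 (himp N)
  have h3 : always χ ∈ M := mem_imp.1 (mp_ax (.ind χ) (M.prov_mem h1.alwaysNec)) hM
  exact mem_imp.1 (mp_ax (.alwaysK χ ψ) (M.prov_mem h2.alwaysNec)) h3

theorem hist_mem_of_invariant {χ : Fml h C V P} (hstep : ∀ N : World CS, χ ∈ N → wprev χ ∈ N)
    (himp : ∀ N : World CS, χ ∈ N → ψ ∈ N) (hM : χ ∈ M) : hist ψ ∈ M := by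
  have h1 : Prov CS (imp χ (wprev χ)) := prov_iff_forall_mem.2 fun N => mem_imp.2 (hstep N)
  have h2 : Prov CS (imp χ ψ) := prov_iff_forall_mem.2 fun N => mem_imp.2 (himp N)
  have h3 : hist χ ∈ M := mem_imp.1 (mp_ax (.histInd χ) (M.prov_mem h1.histNec)) hM
  exact mem_imp.1 (mp_ax (.histK χ ψ) (M.prov_mem h2.histNec)) h3

end World

/-! ### Worlds up to agreement on a finite set of formulas -/

/-- The worlds `M` and `N` contain the same formulas of `S`. -/
def Agree (S : Set (Fml h C V P)) (M N : World CS) : Prop := ∀ θ ∈ S, θ ∈ M ↔ θ ∈ N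

theorem Agree.refl (S : Set (Fml h C V P)) (M : World CS) : Agree S M M := fun _ _ => Iff.rfl

theorem Agree.symm {S : Set (Fml h C V P)} {M N : World CS} (hMN : Agree S M N) : Agree S N M :=
  fun θ hθ => (hMN θ hθ).symm

theorem Agree.trans {S : Set (Fml h C V P)} {M N K : World CS} (hMN : Agree S M N)
    (hNK : Agree S N K) : Agree S M K := fun θ hθ => (hMN θ hθ).trans (hNK θ hθ)

/-- A set of worlds that depends only on the formulas of a finite set is defined by a formula. The
induction on the finite set is a Boole–Shannon expansion. -/
theorem exists_defining_formula {S : Set (Fml h C V P)} (hS : S.Finite) (R : World CS → Prop)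
    (hR : ∀ M N, Agree S M N → R M → R N) : ∃ χ : Fml h C V P, ∀ M : World CS, χ ∈ M ↔ R M := by
  induction S, hS using Set.Finite.induction_on generalizing R with
  | empty =>
    by_cases hex : ∃ M, R M
    · obtain ⟨M, hM⟩ := hex
      exact ⟨top, fun N => ⟨fun _ => hR M N (fun θ hθ => absurd hθ (Set.notMem_empty θ)) hM,
        fun _ => World.mem_neg.2 N.bot_notMem⟩⟩
    · push Not at hex
      exact ⟨bot, fun N => ⟨fun hb => absurd hb N.bot_notMem, fun hN => absurd hN (hex N)⟩⟩
  | @insert σ S _ _ ih =>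
    obtain ⟨χ₁, h₁⟩ := ih (fun M => ∃ N, Agree S M N ∧ σ ∈ N ∧ R N)
      fun M N hMN ⟨K, hK, hKR⟩ => ⟨K, hMN.symm.trans hK, hKR⟩
    obtain ⟨χ₂, h₂⟩ := ih (fun M => ∃ N, Agree S M N ∧ σ ∉ N ∧ R N)
      fun M N hMN ⟨K, hK, hKR⟩ => ⟨K, hMN.symm.trans hK, hKR⟩
    have lift : ∀ M N : World CS, Agree S M N → (σ ∈ M ↔ σ ∈ N) → R N → R M := by
      intro M N hMN hσ
      refine hR N M fun θ hθ => ?_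
      rcases hθ with rfl | hθ
      · exact hσ.symm
      · exact (hMN θ hθ).symm
    refine ⟨Fml.or (Fml.and σ χ₁) (Fml.and (neg σ) χ₂), fun M => ?_⟩
    rw [World.mem_or, World.mem_and, World.mem_and, World.mem_neg, h₁, h₂]
    constructor
    · rintro (⟨hσ, N, hMN, hσN, hN⟩ | ⟨hσ, N, hMN, hσN, hN⟩)
      · exact lift M N hMN (iff_of_true hσ hσN) hN
      · exact lift M N hMN (iff_of_false hσ hσN) hN
    · intro hM
      by_cases hσ : σ ∈ M
      · exact Or.inl ⟨hσ, M, .refl S M, hσ, hM⟩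
      · exact Or.inr ⟨hσ, M, .refl S M, hσ, hM⟩

/-- `N` is the successor of `M` up to agreement on `S`. Both ends are taken up to agreement, so that
the relation is invariant in both arguments. -/
def Step (S : Set (Fml h C V P)) (M N : World CS) : Prop :=
  ∃ K, Agree S M K ∧ Agree S K.succ N

theorem step_succ (S : Set (Fml h C V P)) (M : World CS) : Step S M M.succ :=
  ⟨M, .refl S M, .refl S _⟩

/-! ### Reachability and fair paths -/

/-- `Reach step G n x`: a path of `n` steps leads from `x` to a point of `G`. -/
def Reach {T : Type*} (step : T → T → Prop) (G : T → Prop) : ℕ → T → Prop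
  | 0, x => G x
  | n + 1, x => ∃ y, step x y ∧ Reach step G n y

theorem exists_rank {T : Type*} {step : T → T → Prop} {G : T → Prop}
    (hreach : ∀ x, ∃ n, Reach step G n x) :
    ∃ rank : T → ℕ, ∀ x, ¬ G x → ∃ y, step x y ∧ rank y < rank x := by
  classical
  refine ⟨fun x => Nat.find (hreach x), fun x hx => ?_⟩
  have hspec := Nat.find_spec (hreach x)
  rcases hn : Nat.find (hreach x) with _ | n
  · rw [hn] at hspec
    exact absurd hspec hx
  · rw [hn] at hspec
    obtain ⟨y, hxy, hy⟩ := hspec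
    exact ⟨y, hxy, by have := Nat.find_min' (hreach y) hy; simp only [hn]; omega⟩

/-- If each of countably many goals can be reached from everywhere, then some infinite path meets
every goal infinitely often. -/
theorem exists_fair_path {T ι : Type*} [Countable ι] [Nonempty ι] {step : T → T → Prop}
    {G : ι → T → Prop} (htot : ∀ x, ∃ y, step x y) (hreach : ∀ i x, ∃ n, Reach step (G i) n x)
    (x₀ : T) : ∃ f : ℕ → T, f 0 = x₀ ∧ (∀ n, step (f n) (f (n + 1))) ∧
      ∀ i n, ∃ m, n ≤ m ∧ G i (f m) := by
  classical
  choose rank hrank using fun i => exists_rank (hreach i)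
  have hnext : ∀ i x, ∃ y, step x y ∧ (¬ G i x → rank i y < rank i x) := by
    intro i x
    by_cases hx : G i x
    · obtain ⟨y, hy⟩ := htot x
      exact ⟨y, hy, fun hn => absurd hx hn⟩
    · obtain ⟨y, hy, hlt⟩ := hrank i x hx
      exact ⟨y, hy, fun _ => hlt⟩
  choose nxt hstep hlt using hnext
  obtain ⟨g, hg⟩ := exists_surjective_nat ι
  -- A schedule of goals in which each goal occurs infinitely often.
  let e : ℕ → ι := fun k => g k.unpair.1
  -- The second component counts the scheduled goals that have been met; the goal with this number
  -- is pursued until it is met.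
  let s : ℕ → T × ℕ := fun n => Nat.rec (x₀, 0)
    (fun _ p => (nxt (e p.2) p.1, if G (e p.2) p.1 then p.2 + 1 else p.2)) n
  have hs1 : ∀ n, (s (n + 1)).1 = nxt (e (s n).2) (s n).1 := fun n => rfl
  have hs2 : ∀ n, (s (n + 1)).2 = if G (e (s n).2) (s n).1 then (s n).2 + 1 else (s n).2 :=
    fun n => rfl
  have hmeet : ∀ r n, rank (e (s n).2) (s n).1 ≤ r →
      ∃ m, n ≤ m ∧ (s m).2 = (s n).2 ∧ G (e (s m).2) (s m).1 := by
    intro r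
    induction r with
    | zero =>
      intro n hr
      refine ⟨n, le_rfl, rfl, ?_⟩
      by_contra hG
      have := hlt _ _ hG
      omega
    | succ r ih =>
      intro n hr
      by_cases hG : G (e (s n).2) (s n).1
      · exact ⟨n, le_rfl, rfl, hG⟩
      · have h2 : (s (n + 1)).2 = (s n).2 := by rw [hs2, if_neg hG]
        have := hlt _ _ hG
        obtain ⟨m, hm, hk, hm'⟩ := ih (n + 1) (by rw [h2, hs1]; omega)
        exact ⟨m, by omega, by rw [hk, h2], hm'⟩
  have hadv : ∀ d n, ∃ m, n ≤ m ∧ (s m).2 = (s n).2 + d ∧ G (e (s m).2) (s m).1 := by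
    intro d
    induction d with
    | zero => exact fun n => hmeet _ n le_rfl
    | succ d ih =>
      intro n
      obtain ⟨m, hm, hk, hG⟩ := ih n
      obtain ⟨m', hm', hk', hG'⟩ := hmeet _ (m + 1) le_rfl
      exact ⟨m', by omega, by rw [hk', hs2, if_pos hG]; omega, hG'⟩
  refine ⟨fun n => (s n).1, rfl, fun n => hstep _ _, fun i n => ?_⟩
  obtain ⟨j, rfl⟩ := hg i
  have hle : (s n).2 ≤ Nat.pair j (s n).2 := Nat.right_le_pair j _
  obtain ⟨m, hm, hk, hG⟩ := hadv (Nat.pair j (s n).2 - (s n).2) n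
  refine ⟨m, hm, ?_⟩
  rw [hk, Nat.add_sub_cancel' hle] at hG
  simpa [e] using hG

/-- A path with a property that is insensitive to prefixes can be extended backwards so as to begin
in `G`, if its first point can be reached from `G`. -/
theorem exists_path_of_reach {T : Type*} {step : T → T → Prop} {G : T → Prop}
    {F : (ℕ → T) → Prop} (hF : ∀ f : ℕ → T, F (fun n => f (n + 1)) → F f) {n : ℕ} {f : ℕ → T}
    (hstep : ∀ k, step (f k) (f (k + 1))) (hf : F f)
    (hn : Reach (fun x y => step y x) G n (f 0)) :
    ∃ g : ℕ → T, G (g 0) ∧ (∀ k, step (g k) (g (k + 1))) ∧ F g := by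
  induction n generalizing f with
  | zero => exact ⟨f, hn, hstep, hf⟩
  | succ n ih =>
    obtain ⟨y, hy, hn⟩ := hn
    refine ih (f := fun k => Nat.casesOn k y f) (fun k => ?_) (hF _ hf) hn
    rcases k with _ | k
    · exact hy
    · exact hstep k

theorem reach_of_agree {S : Set (Fml h C V P)} {step : World CS → World CS → Prop}
    {G : World CS → Prop} (hG : ∀ {M N}, Agree S M N → G M → G N)
    (hstep : ∀ {M N K}, Agree S M N → step M K → step N K) {n : ℕ} {M N : World CS}
    (hMN : Agree S M N) (hM : Reach step G n M) : Reach step G n N := by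
  cases n with
  | zero => exact hG hMN hM
  | succ n => exact hM.imp fun K hK => ⟨hstep hMN hK.1, hK.2⟩

/-- If `θ` is an until-formula of `M`, then its second argument belongs to `M` as well. -/
def Fulfilled (θ : Fml h C V P) (M : World CS) : Prop :=
  ∀ φ ψ, θ = untl φ ψ → θ ∈ M → ψ ∈ M

/-- If the until-formula could not be fulfilled, its second argument would fail on a definable set of
worlds closed under successors, hence always, against the axiom `φ U ψ → ◇ψ`. -/
theorem exists_reach_untl {S : Set (Fml h C V P)} (hS : S.Finite) {θ : Fml h C V P} (hθ : θ ∈ S)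
    (hsub : ∀ φ ψ, θ = untl φ ψ → ψ ∈ S) (M : World CS) :
    ∃ n, Reach (Step S) (Fulfilled θ) n M := by
  by_contra hcon
  push Not at hcon
  obtain ⟨χ, hχ⟩ := exists_defining_formula (CS := CS) hS
    (fun N => ∀ n, ¬ Reach (Step S) (Fulfilled θ) n N)
    fun N N' hNN' hN n hn => hN n (reach_of_agree
      (fun {K K'} hKK' hK φ ψ he hK' => (hKK' ψ (hsub φ ψ he)).1 (hK φ ψ he ((hKK' θ hθ).2 hK')))
      (fun hKK' ⟨L, hL, hL'⟩ => ⟨L, hKK'.symm.trans hL, hL'⟩) hNN'.symm hn)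
  have h0 := hcon 0
  simp only [Reach, Fulfilled] at h0
  push Not at h0
  obtain ⟨φ, ψ, rfl, hM, -⟩ := h0
  refine World.mem_neg.1 (World.mp_ax (.untl1 φ ψ) hM) ?_
  refine World.always_mem_of_invariant (χ := χ) (fun N hN => ?_) (fun N hN => ?_) ((hχ M).2 hcon)
  · rw [hχ] at hN ⊢
    exact fun n hn => hN (n + 1) ⟨N.succ, step_succ S N, hn⟩
  · rw [hχ] at hN
    refine World.mem_neg.2 fun hψ => hN 0 fun φ' ψ' he _ => ?_
    cases he
    exact hψ

/-- Worlds from which no initial world can be reached backwards would form a definable set closed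
under predecessors, so that `W⊥` would never have held, against the axiom `once W⊥`. -/
theorem exists_reach_initial {S : Set (Fml h C V P)} (hS : S.Finite) (hbot : wprev bot ∈ S)
    (M : World CS) : ∃ n, Reach (fun M N => Step S N M) (fun N => wprev bot ∈ N) n M := by
  by_contra hcon
  push Not at hcon
  obtain ⟨χ, hχ⟩ := exists_defining_formula (CS := CS) hS
    (fun N => ∀ n, ¬ Reach (fun M N => Step S N M) (fun N => wprev bot ∈ N) n N)
    fun N N' hNN' hN n hn => hN n (reach_of_agree
      (fun {K K'} hKK' => (hKK' _ hbot).1)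
      (fun hKK' ⟨L, hL, hL'⟩ => ⟨L, hL, hL'.trans hKK'⟩) hNN'.symm hn)
  refine World.mem_neg.1 (World.ax_mem (M := M) .initial) ?_
  refine World.hist_mem_of_invariant (χ := χ) (fun N hN => ?_) (fun N hN => ?_) ((hχ M).2 hcon)
  · rw [hχ] at hN
    rw [← World.mem_pred (hN 0), hχ]
    exact fun n hn => hN (n + 1)
      ⟨N.pred (hN 0), ⟨_, .refl S _, fun θ _ => World.mem_succ_pred (hN 0)⟩, hn⟩
  · rw [hχ] at hN
    exact World.mem_neg.2 (hN 0)

/-! ### Finite sets closed under subformulas -/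

/-- The immediate subformulas of a formula. -/
def Fml.children : Fml h C V P → Set (Fml h C V P)
  | atom _ => ∅
  | bot => ∅
  | imp φ ψ => {φ, ψ}
  | next φ => {φ}
  | wprev φ => {φ}
  | untl φ ψ => {φ, ψ}
  | since φ ψ => {φ, ψ}
  | just _ _ φ => {φ}

/-- Closure under immediate subformulas. -/
def SubClosed (S : Set (Fml h C V P)) : Prop := ∀ θ ∈ S, θ.children ⊆ S

theorem SubClosed.insert {S : Set (Fml h C V P)} (hS : SubClosed S) {θ : Fml h C V P}
    (hθ : θ.children ⊆ S) : SubClosed (insert θ S) := by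
  rintro η (rfl | hη)
  · exact hθ.trans (Set.subset_insert _ _)
  · exact (hS η hη).trans (Set.subset_insert _ _)

theorem SubClosed.union {S T : Set (Fml h C V P)} (hS : SubClosed S) (hT : SubClosed T) :
    SubClosed (S ∪ T) := by
  rintro η (hη | hη)
  · exact (hS η hη).trans Set.subset_union_left
  · exact (hT η hη).trans Set.subset_union_right

theorem exists_finite_subClosed (φ : Fml h C V P) :
    ∃ S : Set (Fml h C V P), S.Finite ∧ SubClosed S ∧ φ ∈ S := by
  have extend : ∀ {S : Set (Fml h C V P)} {θ : Fml h C V P}, S.Finite → SubClosed S →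
      θ.children ⊆ S → ∃ S : Set (Fml h C V P), S.Finite ∧ SubClosed S ∧ θ ∈ S :=
    fun {S θ} hfin hS hθ => ⟨insert θ S, hfin.insert θ, hS.insert hθ, Set.mem_insert θ S⟩
  have closed_empty : SubClosed (∅ : Set (Fml h C V P)) := fun θ hθ => absurd hθ (by simp)
  induction φ with
  | atom p => exact extend Set.finite_empty closed_empty subset_rfl
  | bot => exact extend Set.finite_empty closed_empty subset_rfl
  | next φ ih | wprev φ ih | just t i φ ih =>
    obtain ⟨S, hfin, hS, hφ⟩ := ih
    exact extend hfin hS (Set.singleton_subset_iff.2 hφ)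
  | imp φ ψ ih₁ ih₂ | untl φ ψ ih₁ ih₂ | since φ ψ ih₁ ih₂ =>
    obtain ⟨S, hfin, hS, hφ⟩ := ih₁
    obtain ⟨T, hfin', hT, hψ⟩ := ih₂
    exact extend (hfin.union hfin') (hS.union hT) (Set.pair_subset (Or.inl hφ) (Or.inr hψ))

/-! ### The canonical run -/

/-- A run of worlds as a model: positions serve as states, and `φ` is evidence for `t` iff `[t]_i φ`
belongs to the world at that position. -/
def runModel (f : ℕ → World CS) : MModel.{u, v, w, x} CS where
  S := ULift ℕ
  nonempty := ⟨⟨0⟩⟩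
  r n := ⟨n⟩
  E i s t := {φ | just t i φ ∈ f s.down}
  evidence i :=
    { constSpec := fun s _ _ hφ => (f s.down).prov_mem (.iaxNec hφ)
      application := fun _ t₁ t₂ φ ψ h₁ h₂ =>
        World.mem_imp.1 (World.mp_ax (.application t₁ t₂ i φ ψ) h₁) h₂
      sum := by
        rintro s t₁ t₂ φ (hφ | hφ)
        · exact World.mp_ax (.sumLeft t₁ t₂ i φ) hφ
        · exact World.mp_ax (.sumRight t₁ t₂ i φ) hφ
      posIntrospection := fun _ t φ hφ => World.mp_ax (.posIntrospection t i φ) hφ }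
  ν s := {p | atom p ∈ f s.down}

/-- The truth lemma. -/
theorem sat_iff_mem {S : Set (Fml h C V P)} (hS : SubClosed S) {f : ℕ → World CS}
    (h0 : wprev bot ∈ f 0) (hstep : ∀ n, Step S (f n) (f (n + 1)))
    (hfair : ∀ θ ∈ S, ∀ n, ∃ m, n ≤ m ∧ Fulfilled θ (f m)) {θ : Fml h C V P} (hθ : θ ∈ S) (n : ℕ) :
    (runModel.{u, v, w, x} f).Sat θ n ↔ θ ∈ f n := by
  induction θ generalizing n with
  | atom p => exact Iff.rfl
  | bot => exact World.mem_bot.symm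
  | imp φ ψ ih₁ ih₂ =>
    rw [MModel.sat_imp, World.mem_imp, ih₁ (hS _ hθ (Or.inl rfl)), ih₂ (hS _ hθ (Or.inr rfl))]
  | next φ ih =>
    have hφ : φ ∈ S := hS _ hθ rfl
    obtain ⟨K, hK, hK'⟩ := hstep n
    rw [MModel.sat_next, ih hφ, hK _ hθ, ← World.mem_succ, hK' _ hφ]
  | wprev φ ih =>
    have hφ : φ ∈ S := hS _ hθ rfl
    rw [MModel.sat_wprev]
    rcases n with _ | n
    · exact iff_of_true (Or.inl rfl) (World.mem_wprev_of_initial h0)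
    · obtain ⟨K, hK, hK'⟩ := hstep n
      rw [Nat.add_sub_cancel, ih hφ, ← hK' _ hθ, World.wprev_mem_succ, hK _ hφ]
      simp
  | untl φ ψ ih₁ ih₂ =>
    have hφ : φ ∈ S := hS _ hθ (Or.inl rfl)
    have hψ : ψ ∈ S := hS _ hθ (Or.inr rfl)
    have unfold_mem : ∀ n, untl φ ψ ∈ f n ↔ ψ ∈ f n ∨ (φ ∈ f n ∧ untl φ ψ ∈ f (n + 1)) := by
      intro n
      obtain ⟨K, hK, hK'⟩ := hstep n
      rw [hK _ hθ, World.mem_untl, hK' _ hθ, hK _ hφ, hK _ hψ]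
    have sat_of_mem : ∀ d n, Fulfilled (untl φ ψ) (f (n + d)) → untl φ ψ ∈ f n →
        (runModel.{u, v, w, x} f).Sat (untl φ ψ) n := by
      intro d
      induction d with
      | zero =>
        intro n hd hn
        rw [MModel.sat_untl_unfold, ih₂ hψ]
        exact Or.inl (hd φ ψ rfl hn)
      | succ d ih =>
        intro n hd hn
        rw [MModel.sat_untl_unfold, ih₁ hφ, ih₂ hψ]
        refine ((unfold_mem n).1 hn).imp_right (And.imp_right (ih (n + 1) ?_))
        rwa [Nat.add_right_comm]
    constructor
    · rintro ⟨m, hm, hm', hk⟩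
      have hmem : ∀ k, k ≤ m → n ≤ k → untl φ ψ ∈ f k := fun k hkm =>
        Nat.decreasingInduction (motive := fun k _ => n ≤ k → untl φ ψ ∈ f k)
          (fun k hkm ih hnk =>
            (unfold_mem k).2 (Or.inr ⟨(ih₁ hφ k).1 (hk k hnk hkm), ih (by omega)⟩))
          (fun _ => (unfold_mem m).2 (Or.inl ((ih₂ hψ m).1 hm'))) hkm
      exact hmem n hm le_rfl
    · intro hn
      obtain ⟨m, hm, hful⟩ := hfair _ hθ n
      exact sat_of_mem (m - n) n (by rwa [Nat.add_sub_cancel' hm]) hn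
  | since φ ψ ih₁ ih₂ =>
    have hφ : φ ∈ S := hS _ hθ (Or.inl rfl)
    have hψ : ψ ∈ S := hS _ hθ (Or.inr rfl)
    induction n with
    | zero =>
      have := World.mem_wprev_of_initial (φ := neg (since φ ψ)) h0
      rw [MModel.sat_since_unfold, World.mem_since, ih₂ hψ]
      tauto
    | succ n ih =>
      obtain ⟨K, hK, hK'⟩ := hstep n
      rw [MModel.sat_since_unfold, Nat.add_sub_cancel, propext ih, ih₁ hφ, ih₂ hψ, ← hK' _ hθ,
        World.mem_since_succ, hK' _ hφ, hK' _ hψ, hK _ hθ]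
      simp
  | just t i φ ih =>
    rw [MModel.sat_just, ih (hS _ hθ rfl)]
    exact ⟨And.left, fun hn => ⟨hn, World.mp_ax (.reflexivity t i φ) hn⟩⟩

/-! ### Completeness -/

theorem exists_model_sat_iff_mem (M : World CS) (φ : Fml h C V P) :
    ∃ (N : MModel.{u, v, w, x} CS) (n : ℕ), N.Sat φ n ↔ φ ∈ M := by
  -- Any formula that has both `φ` and `W⊥` as subformulas will do here.
  obtain ⟨S, hfin, hS, hmem⟩ := exists_finite_subClosed (imp φ (wprev bot))
  have hφ : φ ∈ S := hS _ hmem (Or.inl rfl)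
  have hbot : wprev bot ∈ S := hS _ hmem (Or.inr rfl)
  have : Countable S := hfin.countable
  have : Nonempty S := ⟨⟨φ, hφ⟩⟩
  obtain ⟨f, hf0, hfstep, hffair⟩ := exists_fair_path (step := Step S)
    (G := fun θ : S => Fulfilled θ.1) (fun N => ⟨N.succ, step_succ S N⟩)
    (fun θ => exists_reach_untl hfin θ.2 fun α β he => hS _ θ.2 (he ▸ Or.inr rfl)) M
  obtain ⟨n, hn⟩ := exists_reach_initial hfin hbot M
  obtain ⟨g, hg0, hgstep, hgfair, k, hk⟩ := exists_path_of_reach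
    (F := fun g => (∀ θ ∈ S, ∀ n, ∃ m, n ≤ m ∧ Fulfilled θ (g m)) ∧ ∃ k, g k = M)
    (fun g ⟨hg, k, hk⟩ => ⟨fun θ hθ n => by
      obtain ⟨m, hm, hful⟩ := hg θ hθ n
      exact ⟨m + 1, by omega, hful⟩, k + 1, hk⟩)
    hfstep ⟨fun θ hθ => hffair ⟨θ, hθ⟩, 0, hf0⟩ (hf0 ▸ hn)
  exact ⟨runModel g, k, by rw [sat_iff_mem hS hg0 hgstep hgfair hφ, hk]⟩

theorem prov_of_forall_valid {φ : Fml h C V P} (hφ : ∀ M : MModel.{u, v, w, x} CS, M.Valid φ) :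
    Prov CS φ := by
  refine prov_iff_forall_mem.2 fun M => ?_
  obtain ⟨N, n, hN⟩ := exists_model_sat_iff_mem.{u, v, w, x} M φ
  exact hN.1 (hφ N n)

theorem Prov.derives {φ : Fml h C V P} (hφ : Prov CS φ) : Derives CS ∅ φ := by
  induction hφ with
  | ax hφ => exact .ax hφ
  | mp _ _ ih₁ ih₂ => exact Set.union_self (∅ : Set (Fml h C V P)) ▸ Derives.mp ih₁ ih₂
  | iaxNec hφ => exact .iaxNec hφ
  | nextNec hφ => exact .nextNec hφ
  | wprevNec hφ => exact .wprevNec hφ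
  | alwaysNec hφ => exact .alwaysNec hφ
  | histNec hφ => exact .histNec hφ

/-- Finitely many assumptions are moved into the formula as antecedents. -/
theorem derives_of_conseq {Γ : Set (Fml h C V P)} (hΓ : Γ.Finite) {φ : Fml h C V P}
    (hφ : Conseq.{u, v, w, x} CS Γ φ) : Derives CS Γ φ := by
  induction Γ, hΓ using Set.Finite.induction_on generalizing φ with
  | empty => exact (prov_of_forall_valid fun M n => hφ M n fun ψ hψ => absurd hψ (by simp)).derives
  | @insert γ Γ _ _ ih =>
    have himp : Derives CS Γ (imp γ φ) := ih fun M n hM => (M.sat_imp γ φ n).2 fun hγ =>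
      hφ M n fun ψ hψ => hψ.elim (fun he => he ▸ hγ) (hM ψ)
    exact Derives.mp (Derives.prem (Set.mem_singleton γ)) himp

end LPLTLP

theorem mainTheorem3 (h : ℕ) (C : Type u) (V : Type v) (P : Type w)
    (CS : Set (LPLTLP.Fml h C V P)) (hCS : LPLTLP.IsConstSpec CS) :
    (∀ φ : LPLTLP.Fml h C V P,
      LPLTLP.Prov CS φ ↔ ∀ M : LPLTLP.MModel.{u, v, w, x} CS, M.Valid φ) ∧
    (∀ (Γ : Set (LPLTLP.Fml h C V P)) (φ : LPLTLP.Fml h C V P), Γ.Finite →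
      (LPLTLP.Derives CS Γ φ ↔ LPLTLP.Conseq.{u, v, w, x} CS Γ φ)) :=
  ⟨fun _ => ⟨fun hφ M => hφ.valid hCS M, LPLTLP.prov_of_forall_valid⟩,
    fun _ _ hΓ => ⟨LPLTLP.Derives.conseq hCS, LPLTLP.derives_of_conseq hΓ⟩⟩
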